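/- Let $\mathcal K$ be a locally small 2-category with small bicolimits and let $\mathcal H$ be a set of 1-cells of $\mathcal K$. *Kan injectivity.* For $h\colon A\to A'$ and $f\colon A\to P$ write $(f/h,\ \xi_f\colon f\Rightarrow (f/h)h)$ for the left Kan extension of $f$ along $h$. An object $P$ is *left Kan injective* with respect to a class $\mathcal H$ of 1-cells if, for all $h\colon A\to A'$ in $\mathcal H$ and all $f\colon A\to P$, $(f/h,\xi_f)$ exists and $\xi_f$ is invertible. A 1-cell $u\colon P\to Q$ is left Kan injective with respect to $\mathcal H$ if $P$ and $Q$ are so and $u$ preserves left Kan extensions along the 1-cells in $\mathcal H$. $\mathbf{LInj}(\mathcal H)$ is the locally full sub-2-category of these objects and 1-cells. *Kan injective pseudochain.* Call an ordinal even if it is $\lambda+2n$ with $n<\omega$ and $\lambda$ zero or a limit. For an object $X$, the Kan injective pseudochain is a normal pseudofunctor $\mathbf{Ord}\to\mathcal K$ with objects $X_i$, connecting 1-cells $x_{ij}\colon X_i\to X_j$ ($i\le j$) and compositors $\mathbf x_{ik}^j\colon x_{jk}x_{ij}\cong x_{ik}$, constructed (by any choice of the bicolimits) as follows. - $X_0=X$.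 For $\kappa$ a limit ordinal, $X_\kappa$, with the $x_{i\kappa}$ and the compositors, is a bicolimit of the $X_i$, $i<\kappa$. - For $i$ even, $x_{i,i+1}$ and 1-cells $f/\!/h\colon A'\to X_{i+1}$, with invertible 2-cells $\tilde\xi_f^h\colon x_{i,i+1}f\cong (f/\!/h)h$, form the conical bicolimit of the diagram of all spans $X_i\xleftarrow{f}A\xrightarrow{h}A'$ with $h\in\mathcal H$. - For $i$ even, $x_{i+1,i+2}$ is the wide bipushout of the following 1-cells $c_\gamma\colon X_{i+1}\to C_\gamma$. (a) For each 2-cell $\gamma\colon x_{j,i+1}f\Rightarrow gh$ with $h\colon A\to A'$ in $\mathcal H$, $f\colon A\to X_j$, $g\colon A'\to X_{i+1}$ and $j\le i$ even: let $\gamma'\colon x_{j+1,i+1}(f/\!/h)h\cong x_{j+1,i+1}x_{j,j+1}f\cong x_{j,i+1}f\Rightarrow gh$ be the composite of $(\tilde\xi_f^h)^{-1}$, the compositor and $\gamma$. Then $c_\gamma$ is the bicoequinserter of $\gamma'$, i.e. the universal 1-cell equipped with a 2-cell $\chi\colon c_\gamma x_{j+1,i+1}(f/\!/h)\Rightarrow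 c_\gamma g$ such that $\chi\circ h=c_\gamma\circ\gamma'$. (b) For each pair $\gamma=\{\sigma,\tau\}$ of 2-cells $\sigma,\tau\colon x_{j+1,i+1}(f/\!/h)\Rightarrow g$, with $h,f,g,j$ as in (a), such that $\sigma\circ h=\tau\circ h$: $c_\gamma$ is the bicoequifier of $\sigma$ and $\tau$. **Lemma.** For every object $X$ and every ordinal $i$, each object and each 1-cell of $\mathbf{LInj}(\mathcal H)$ is left Kan injective with respect to $x_{0i}\colon X_0\to X_i$; that is, $$\mathbf{LInj}(\mathcal H)\subseteq\mathbf{LInj}(\{x_{0i}\mid X\in\mathcal K\}).$$ Consequently, for each $p_0\colon X_0\to P$ with $P\in\mathbf{LInj}(\mathcal H)$, there is a pseudococone on the pseudochain, given by 1-cells $p_i\colon X_i\to P$ (the given $p_0$ for $i=0$) and invertible 2-cells $\mathbf p_{ij}\colon p_i\Rightarrow p_jx_{ij}$ ($i\le j$) compatible with identities and compositors, such that for every ordinal $i$ the pair $(p_i,\mathbf p_{0i})$ is a left Kan extension of $p_0$ along $x_{0i}$, i.e. $p_i\cong p_0/x_{0i}$. Any two such pseudococones are isomorphic by a unique isomorphism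 of pseudococones that is the identity at $p_0$. -/

import Mathlib

open CategoryTheory Bicategory

universe t s w v u

namespace KanInjective

/-! ### Left Kan injectivity -/

section LInj

variable {K : Type u} [Bicategory.{w, v} K]

/-- `P` is left Kan injective with respect to the class `H` of 1-cells: for every `h : A ⟶ A'` in
`H` and every `f : A ⟶ P` there is a left Kan extension of `f` along `h` whose universal 2-cell is
invertible. These are the objects of `LInj(H)`. -/
def IsLeftKanInjective (H : MorphismProperty K) (P : K) : Prop :=
  ∀ ⦃A A' : K⦄ (h : A ⟶ A'), H h → ∀ f : A ⟶ P,
    ∃ e : LeftExtension h f, Nonempty e.IsKan ∧ IsIso e.unit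

/-- `p : P ⟶ Q` is left Kan injective with respect to `H`: so are `P` and `Q`, and `p` preserves
all left Kan extensions along 1-cells in `H`. These are the 1-cells of the locally full
sub-2-category `LInj(H)`. -/
def IsLeftKanInjectiveHom (H : MorphismProperty K) {P Q : K} (p : P ⟶ Q) : Prop :=
  IsLeftKanInjective H P ∧ IsLeftKanInjective H Q ∧
    ∀ ⦃A A' : K⦄ (h : A ⟶ A'), H h → ∀ (f : A ⟶ P) (e : LeftExtension h f),
      Nonempty e.IsKan → Nonempty (e.whisker p).IsKan

end LInj

/-! ### Pseudochains, pseudococones and their bicolimits -/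

/-- A pseudochain indexed by the preorder `I`: a normal (strictly unitary) pseudofunctor from `I`,
seen as a locally discrete 2-category, to `K`. -/
abbrev Pseudochain (I : Type t) [Preorder I] (K : Type u) [Bicategory.{w, v} K] :=
  StrictlyUnitaryPseudofunctor (LocallyDiscrete I) K

namespace Pseudochain

variable {I : Type t} [Preorder I] {J : Type s} [Preorder J] {K : Type u} [Bicategory.{w, v} K]

/-- The object `X_i`. -/
def X (F : Pseudochain I K) (i : I) : K := F.obj ⟨i⟩

/-- The connecting 1-cell `x_{i,j} : X_i ⟶ X_j`. -/
def x (F : Pseudochain I K) {i j : I} (h : i ≤ j) : F.X i ⟶ F.X j := F.map (homOfLE h).toLoc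

/-- The identity `x_{i,i} = 1` as an invertible 2-cell. -/
def xId (F : Pseudochain I K) (i : I) : F.x (le_refl i) ≅ 𝟙 (F.X i) := F.mapId ⟨i⟩

/-- The compositor `x_{i,k} ≅ x_{j,k} x_{i,j}`. -/
def xComp (F : Pseudochain I K) {i j k : I} (hij : i ≤ j) (hjk : j ≤ k) :
    F.x (hij.trans hjk) ≅ F.x hij ≫ F.x hjk :=
  F.mapComp (homOfLE hij).toLoc (homOfLE hjk).toLoc

theorem xComp_assoc (F : Pseudochain I K) {i j k l : I} (hij : i ≤ j) (hjk : j ≤ k) (hkl : k ≤ l) :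
    (F.xComp (hij.trans hjk) hkl).hom ≫ (F.xComp hij hjk).hom ▷ F.x hkl ≫
        (α_ (F.x hij) (F.x hjk) (F.x hkl)).hom =
      (F.xComp hij (hjk.trans hkl)).hom ≫ F.x hij ◁ (F.xComp hjk hkl).hom := by
  have h : 𝟙 _ = (F.xComp (hij.trans hjk) hkl).hom ≫ (F.xComp hij hjk).hom ▷ F.x hkl ≫
      (α_ (F.x hij) (F.x hjk) (F.x hkl)).hom ≫ F.x hij ◁ (F.xComp hjk hkl).inv ≫
        (F.xComp hij (hjk.trans hkl)).inv :=
    (F.map₂_id _).symm.trans (F.map₂_associator (homOfLE hij).toLoc (homOfLE hjk).toLoc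
      (homOfLE hkl).toLoc)
  have h' := congrArg (· ≫ (F.xComp hij (hjk.trans hkl)).hom ≫ F.x hij ◁ (F.xComp hjk hkl).hom) h
  simpa using h'.symm

/-- Reindexing of a pseudochain along a monotone map. -/
def restrict (F : Pseudochain J K) (g : I →o J) : Pseudochain I K where
  obj i := F.obj ⟨g i.as⟩
  map f := F.map (homOfLE (g.monotone f.as.le)).toLoc
  map₂ η := eqToHom (by obtain rfl := LocallyDiscrete.eq_of_hom η; rfl)
  map₂_whisker_left _ _ _ η := by
    obtain rfl := LocallyDiscrete.eq_of_hom η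
    simp
  map₂_whisker_right η _ := by
    obtain rfl := LocallyDiscrete.eq_of_hom η
    simp
  mapId i := F.mapId ⟨g i.as⟩
  mapComp f h := F.mapComp (homOfLE (g.monotone f.as.le)).toLoc (homOfLE (g.monotone h.as.le)).toLoc
  map₂_associator f h k :=
    (F.map₂_id _).symm.trans (F.map₂_associator (homOfLE (g.monotone f.as.le)).toLoc
      (homOfLE (g.monotone h.as.le)).toLoc (homOfLE (g.monotone k.as.le)).toLoc)
  map₂_left_unitor f :=
    (F.map₂_id _).symm.trans (F.map₂_left_unitor (homOfLE (g.monotone f.as.le)).toLoc)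
  map₂_right_unitor f :=
    (F.map₂_id _).symm.trans (F.map₂_right_unitor (homOfLE (g.monotone f.as.le)).toLoc)
  map_id i := F.map_id ⟨g i.as⟩
  mapId_eq_eqToIso i := F.mapId_eq_eqToIso ⟨g i.as⟩

/-- The restriction of a pseudochain to the indices strictly below `k`. -/
def below (F : Pseudochain I K) (k : I) : Pseudochain (Set.Iio k) K :=
  F.restrict (OrderHom.Subtype.val (· ∈ Set.Iio k))

end Pseudochain

/-- A pseudococone with vertex `P` on a pseudochain: 1-cells `p_i : X_i ⟶ P` and invertible 2-cells
`p_{i,j} : p_i ⟶ p_j x_{i,j}`, compatible with identities and compositors. -/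
structure Pseudococone {I : Type t} [Preorder I] {K : Type u} [Bicategory.{w, v} K]
    (F : Pseudochain I K) (P : K) where
  leg (i : I) : F.X i ⟶ P
  iso {i j : I} (h : i ≤ j) : leg i ≅ F.x h ≫ leg j
  iso_refl (i : I) :
    (iso (le_refl i)).hom ≫ (F.xId i).hom ▷ leg i ≫ (λ_ (leg i)).hom = 𝟙 (leg i)
  iso_trans {i j k : I} (hij : i ≤ j) (hjk : j ≤ k) :
    (iso (hij.trans hjk)).hom ≫ (F.xComp hij hjk).hom ▷ leg k ≫
        (α_ (F.x hij) (F.x hjk) (leg k)).hom =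
      (iso hij).hom ≫ F.x hij ◁ (iso hjk).hom

namespace Pseudococone

variable {I : Type t} [Preorder I] {K : Type u} [Bicategory.{w, v} K]
  {F : Pseudochain I K} {P Q : K}

/-- A family of 2-cells between the legs of two pseudococones is a modification, i.e. a 2-cell of
pseudococones. -/
def IsModification (c d : Pseudococone F P) (θ : ∀ i, c.leg i ⟶ d.leg i) : Prop :=
  ∀ ⦃i j : I⦄ (h : i ≤ j), θ i ≫ (d.iso h).hom = (c.iso h).hom ≫ F.x h ◁ θ j

/-- Postcomposition of a pseudococone with a 1-cell. -/
def whisker (c : Pseudococone F P) (r : P ⟶ Q) : Pseudococone F Q where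
  leg i := c.leg i ≫ r
  iso h := whiskerRightIso (c.iso h) r ≪≫ α_ _ _ _
  iso_refl i := by
    have := congrArg (· ▷ r) (c.iso_refl i)
    simpa using this
  iso_trans hij hjk := by
    have := congrArg (fun z ↦ z ▷ r ≫ (α_ _ _ _).hom ≫ _ ◁ (α_ _ _ _).hom)
      (c.iso_trans hij hjk)
    simpa [pentagon] using this

/-- `c` is a (conical) bicolimit: for every `Q`, postcomposition with `c` is an equivalence from
1-cells `P ⟶ Q` to pseudococones with vertex `Q`, i.e. it is essentially surjective and fully
faithful. -/
structure IsBicolimit (c : Pseudococone F P) : Prop where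
  exists_desc {Q : K} (d : Pseudococone F Q) :
    ∃ (r : P ⟶ Q) (θ : ∀ i, (c.whisker r).leg i ≅ d.leg i),
      IsModification (c.whisker r) d (fun i ↦ (θ i).hom)
  existsUnique_hom {Q : K} (r r' : P ⟶ Q) (θ : ∀ i, (c.whisker r).leg i ⟶ (c.whisker r').leg i) :
    IsModification (c.whisker r) (c.whisker r') θ → ∃! ρ : r ⟶ r', ∀ i, c.leg i ◁ ρ = θ i

end Pseudococone

/-- The pseudococone with vertex `X_k` on the part of a pseudochain strictly below `k`, given by the
connecting 1-cells and the compositors. -/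
def Pseudochain.belowCocone {I : Type t} [Preorder I] {K : Type u} [Bicategory.{w, v} K]
    (F : Pseudochain I K) (k : I) : Pseudococone (F.below k) (F.X k) where
  leg i := F.x (le_of_lt i.2)
  iso {i j} h := F.xComp (show i.1 ≤ j.1 from h) (le_of_lt j.2)
  iso_refl i := by
    have := F.map₂_left_unitor (homOfLE (le_of_lt i.2)).toLoc
    exact this.symm.trans (F.map₂_id _)
  iso_trans {i j l} hij hjk := by
    exact F.xComp_assoc (show i.1 ≤ j.1 from hij) (show j.1 ≤ l.1 from hjk) (le_of_lt l.2)

/-! ### The bicolimits used in the isolated steps -/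

section Shapes

variable {K : Type u} [Bicategory.{w, v} K]

/-- A pseudococone on the diagram of all spans `X ⟵ A ⟶ A'` with right leg `h` in `H` and arbitrary
left leg `f`: a 1-cell `x : X ⟶ Y`, 1-cells `f//h : A' ⟶ Y` and invertible 2-cells
`x f ≅ (f//h) h`. -/
structure SpanCocone (H : MorphismProperty K) {X Y : K} (x : X ⟶ Y) where
  leg {A A' : K} (h : A ⟶ A') (hh : H h) (f : A ⟶ X) : A' ⟶ Y
  sq {A A' : K} (h : A ⟶ A') (hh : H h) (f : A ⟶ X) : f ≫ x ≅ h ≫ leg h hh f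

/-- The conical bicolimit of the diagram of all spans `X ⟵ A ⟶ A'` with right leg in `H`, i.e. the
wide bipushout of the bipushouts of all these spans. -/
structure SpanCocone.IsBicolimit {H : MorphismProperty K} {X Y : K} {x : X ⟶ Y}
    (c : SpanCocone H x) : Prop where
  exists_desc {Z : K} (y : X ⟶ Z) (d : SpanCocone H y) :
    ∃ (r : Y ⟶ Z) (τ : x ≫ r ≅ y)
      (τ' : ∀ ⦃A A' : K⦄ (h : A ⟶ A') (hh : H h) (f : A ⟶ X), c.leg h hh f ≫ r ≅ d.leg h hh f),
      ∀ ⦃A A' : K⦄ (h : A ⟶ A') (hh : H h) (f : A ⟶ X),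
        f ◁ τ.hom ≫ (d.sq h hh f).hom =
          (α_ f x r).inv ≫ (c.sq h hh f).hom ▷ r ≫ (α_ h (c.leg h hh f) r).hom ≫
            h ◁ (τ' h hh f).hom
  existsUnique_hom {Z : K} (r r' : Y ⟶ Z) (θ : x ≫ r ⟶ x ≫ r')
      (θ' : ∀ ⦃A A' : K⦄ (h : A ⟶ A') (hh : H h) (f : A ⟶ X),
        c.leg h hh f ≫ r ⟶ c.leg h hh f ≫ r') :
    (∀ ⦃A A' : K⦄ (h : A ⟶ A') (hh : H h) (f : A ⟶ X),
      f ◁ θ ≫ (α_ f x r').inv ≫ (c.sq h hh f).hom ▷ r' ≫ (α_ h (c.leg h hh f) r').hom =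
        (α_ f x r).inv ≫ (c.sq h hh f).hom ▷ r ≫ (α_ h (c.leg h hh f) r).hom ≫
          h ◁ θ' h hh f) →
    ∃! ρ : r ⟶ r', x ◁ ρ = θ ∧
      ∀ ⦃A A' : K⦄ (h : A ⟶ A') (hh : H h) (f : A ⟶ X), c.leg h hh f ◁ ρ = θ' h hh f

/-- `x : X ⟶ Y`, `d_γ : C_γ ⟶ Y` and `δ_γ : x ≅ d_γ c_γ` form a wide bipushout of the family of
1-cells `c_γ : X ⟶ C_γ`. -/
structure IsWideBipushout {ι : Type s} {X Y : K} {C : ι → K} (c : ∀ γ, X ⟶ C γ) (x : X ⟶ Y)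
    (d : ∀ γ, C γ ⟶ Y) (δ : ∀ γ, x ≅ c γ ≫ d γ) : Prop where
  exists_desc {Z : K} (y : X ⟶ Z) (e : ∀ γ, C γ ⟶ Z) (η : ∀ γ, y ≅ c γ ≫ e γ) :
    ∃ (r : Y ⟶ Z) (τ : x ≫ r ≅ y) (τ' : ∀ γ, d γ ≫ r ≅ e γ), ∀ γ,
      τ.hom ≫ (η γ).hom = (δ γ).hom ▷ r ≫ (α_ (c γ) (d γ) r).hom ≫ c γ ◁ (τ' γ).hom
  existsUnique_hom {Z : K} (r r' : Y ⟶ Z) (θ : x ≫ r ⟶ x ≫ r') (θ' : ∀ γ, d γ ≫ r ⟶ d γ ≫ r') :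
    (∀ γ, θ ≫ (δ γ).hom ▷ r' ≫ (α_ (c γ) (d γ) r').hom =
      (δ γ).hom ▷ r ≫ (α_ (c γ) (d γ) r).hom ≫ c γ ◁ θ' γ) →
    ∃! ρ : r ⟶ r', x ◁ ρ = θ ∧ ∀ γ, d γ ◁ ρ = θ' γ

/-- `q : C ⟶ Q` and `φ : q f ⟶ q g` form a bicoequinserter of `γ : f h ⟶ g h`. -/
structure IsBicoequinserter {A B C Q : K} (h : A ⟶ B) {f g : B ⟶ C} (γ : h ≫ f ⟶ h ≫ g)
    (q : C ⟶ Q) (φ : f ≫ q ⟶ g ≫ q) : Prop where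
  condition : (α_ h f q).inv ≫ γ ▷ q ≫ (α_ h g q).hom = h ◁ φ
  exists_desc {R : K} (y : C ⟶ R) (ψ : f ≫ y ⟶ g ≫ y) :
    (α_ h f y).inv ≫ γ ▷ y ≫ (α_ h g y).hom = h ◁ ψ →
    ∃ (r : Q ⟶ R) (τ : q ≫ r ≅ y),
      f ◁ τ.hom ≫ ψ = (α_ f q r).inv ≫ φ ▷ r ≫ (α_ g q r).hom ≫ g ◁ τ.hom
  existsUnique_hom {R : K} (r r' : Q ⟶ R) (θ : q ≫ r ⟶ q ≫ r') :
    f ◁ θ ≫ (α_ f q r').inv ≫ φ ▷ r' ≫ (α_ g q r').hom =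
      (α_ f q r).inv ≫ φ ▷ r ≫ (α_ g q r).hom ≫ g ◁ θ →
    ∃! ρ : r ⟶ r', q ◁ ρ = θ

/-- `q : C ⟶ Q` is a bicoequifier of the parallel 2-cells `σ, τ : f ⟶ g`. -/
structure IsBicoequifier {B C Q : K} {f g : B ⟶ C} (σ τ : f ⟶ g) (q : C ⟶ Q) : Prop where
  condition : σ ▷ q = τ ▷ q
  exists_desc {R : K} (y : C ⟶ R) : σ ▷ y = τ ▷ y → ∃ r : Q ⟶ R, Nonempty (q ≫ r ≅ y)
  existsUnique_hom {R : K} (r r' : Q ⟶ R) (θ : q ≫ r ⟶ q ≫ r') : ∃! ρ : r ⟶ r', q ◁ ρ = θ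

end Shapes

/-! ### The Kan injective pseudochain -/

/-- An ordinal is even if it is of the form `l + 2n` with `n` finite and `l` zero or a limit. -/
def IsEven (i : Ordinal.{t}) : Prop :=
  ∃ (l : Ordinal.{t}) (n : ℕ), Order.IsSuccPrelimit l ∧ i = l + (2 * n : ℕ)

section Construction

variable {K : Type u} [Bicategory.{w, v} K] {H : MorphismProperty K}
  {F : Pseudochain Ordinal.{t} K}
  (sp : ∀ j : Ordinal.{t}, IsEven j → SpanCocone H (F.x (le_self_add : j ≤ j + 1)))

/-- The 1-cell `x_{j+1,i+1} (f//h) : A' ⟶ X_{i+1}`. -/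
def spanLeg {i j : Ordinal.{t}} (hj : IsEven j) (hji : j ≤ i) {A A' : K} (h : A ⟶ A') (hh : H h)
    (f : A ⟶ F.X j) : A' ⟶ F.X (i + 1) :=
  (sp j hj).leg h hh f ≫ F.x (by gcongr : j + 1 ≤ i + 1)

/-- The 2-cells `γ : x_{j,i+1} f ⟶ g h` with `h : A ⟶ A'` in `H` and `j ≤ i` even. -/
structure InsIndex (F : Pseudochain Ordinal.{t} K) (H : MorphismProperty K)
    (i : Ordinal.{t}) where
  j : Ordinal.{t}
  even : IsEven j
  le : j ≤ i
  A : K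
  A' : K
  h : A ⟶ A'
  mem : H h
  f : A ⟶ F.X j
  g : A' ⟶ F.X (i + 1)
  γ : f ≫ F.x (le.trans le_self_add) ⟶ h ≫ g

/-- The 2-cell `x_{j+1,i+1} (f//h) h ≅ x_{j+1,i+1} x_{j,j+1} f ≅ x_{j,i+1} f ⟶ g h` built from `γ`,
whose bicoequinserter is taken. -/
def InsIndex.cell {i : Ordinal.{t}} (a : InsIndex F H i) :
    a.h ≫ spanLeg sp a.even a.le a.h a.mem a.f ⟶ a.h ≫ a.g :=
  (α_ _ _ _).inv ≫ ((sp a.j a.even).sq a.h a.mem a.f).inv ▷ _ ≫ (α_ _ _ _).hom ≫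
    a.f ◁ (F.xComp le_self_add (by gcongr; exact a.le : a.j + 1 ≤ i + 1)).inv ≫ a.γ

/-- The pairs of 2-cells `σ, τ : x_{j+1,i+1} (f//h) ⟶ g` with `σ h = τ h`, where `h` is in `H` and
`j ≤ i` is even. The pairs are ordered; since bicoequifiers are fully faithful on 2-cells, listing
both orders does not change the wide bipushout of all of them. -/
structure EqIndex (i : Ordinal.{t}) where
  j : Ordinal.{t}
  even : IsEven j
  le : j ≤ i
  A : K
  A' : K
  h : A ⟶ A'
  mem : H h
  f : A ⟶ F.X j
  g : A' ⟶ F.X (i + 1)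
  σ : spanLeg sp even le h mem f ⟶ g
  τ : spanLeg sp even le h mem f ⟶ g
  eq : h ◁ σ = h ◁ τ

/-- The index set `Γ` of the step from `i + 1` to `i + 2`. -/
abbrev StepIndex (i : Ordinal.{t}) := InsIndex F H i ⊕ EqIndex sp i

/-- The data of the step from `i + 1` to `i + 2`, for `i` even: a bicoequinserter
`c_γ : X_{i+1} ⟶ C_γ` for each `γ` of the first kind, a bicoequifier `c_γ` for each `γ = (σ, τ)` of
the second kind, and 1-cells `d_γ` and 2-cells `δ_γ` making `x_{i+1,i+2}` a wide bipushout of all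
the `c_γ`. -/
structure EvenStep (i : Ordinal.{t}) where
  C : StepIndex sp i → K
  c (γ : StepIndex sp i) : F.X (i + 1) ⟶ C γ
  χ (a : InsIndex F H i) :
    spanLeg sp a.even a.le a.h a.mem a.f ≫ c (.inl a) ⟶ a.g ≫ c (.inl a)
  bicoequinserter (a : InsIndex F H i) :
    IsBicoequinserter a.h (a.cell sp) (c (.inl a)) (χ a)
  bicoequifier (b : EqIndex sp i) : IsBicoequifier b.σ b.τ (c (.inr b))
  d (γ : StepIndex sp i) : C γ ⟶ F.X (i + 1 + 1)
  δ (γ : StepIndex sp i) : F.x (le_self_add : i + 1 ≤ i + 1 + 1) ≅ c γ ≫ d γ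
  wideBipushout : IsWideBipushout c (F.x (le_self_add : i + 1 ≤ i + 1 + 1)) d δ

end Construction

/-- A Kan injective pseudochain for the class `H` of 1-cells, starting at the object `X_0`: a
pseudochain indexed by all ordinals, such that
* for `i` even, `x_{i,i+1}` and the 1-cells `f//h` form a bicolimit of the diagram of all spans
  `X_i ⟵ A ⟶ A'` with right leg in `H`;
* for `i` even, `x_{i+1,i+2}` is a wide bipushout of the bicoequinserters and bicoequifiers `c_γ`;
* for `k` a limit, `X_k` with the `x_{i,k}` and the compositors is a bicolimit of the `X_i`, `i < k`.
No choice of the bicolimits is fixed: every way to carry out the construction gives a term. -/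
structure KanInjectivePseudochain {K : Type u} [Bicategory.{w, v} K] (H : MorphismProperty K) where
  chain : Pseudochain Ordinal.{t} K
  span (i : Ordinal.{t}) (hi : IsEven i) : SpanCocone H (chain.x (le_self_add : i ≤ i + 1))
  span_isBicolimit (i : Ordinal.{t}) (hi : IsEven i) : (span i hi).IsBicolimit
  step (i : Ordinal.{t}) (hi : IsEven i) : EvenStep span i
  limit_isBicolimit (k : Ordinal.{t}) (hk : Order.IsSuccLimit k) :
    (chain.belowCocone k).IsBicolimit

/-- The class of the 1-cells `x_{0i} : X_0 ⟶ X_i`, where `i` runs through all ordinals. -/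
inductive KanInjectivePseudochain.fromZero {K : Type u} [Bicategory.{w, v} K]
    {H : MorphismProperty K} (C : KanInjectivePseudochain.{t} H) : MorphismProperty K
  | mk (i : Ordinal.{t}) : C.fromZero (C.chain.x (zero_le : 0 ≤ i))

/-- The pseudococone `c` on a pseudochain indexed by the ordinals extends `p₀ : X_0 ⟶ P` by left Kan
extensions: its leg at `0` is `p₀`, and each `(p_i, p_{0i})` is a left Kan extension of `p₀` along
`x_{0i}`. -/
def Pseudococone.IsKanExtensionOf {K : Type u} [Bicategory.{w, v} K]
    {F : Pseudochain Ordinal.{t} K} {P : K} (c : Pseudococone F P) (p₀ : F.X 0 ⟶ P) : Prop :=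
  c.leg 0 = p₀ ∧ ∀ i : Ordinal.{t},
    Nonempty (LeftExtension.mk (c.leg i) (c.iso (zero_le : 0 ≤ i)).hom).IsKan

end KanInjective

/-! When units are invertible, a left Kan extension may be replaced by a property of a 1-cell `g`
alone: 2-cells out of `g` correspond bijectively to 2-cells out of its restriction `h ≫ g`. This
property, `IsKanAlong`, is invariant under isomorphism and closed under pasting. The invariant that
drives the proof is `IsSpanKan`: `p : X_k ⟶ P` turns every formal extension `f//h` available in
`X_k` into a genuine Kan extension along `h`. Three facts carry the theorem. Such a `p` is the Kan
extension of its restriction to `X_0` (`IsSpanKan.isKanAlong`). This is a transfinite induction on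
the 2-dimensional universal properties of the bicolimits, with no condition on `P`. If `P` is
injective, every `p₀` extends to such a `p` at every stage (`exists_isSpanKan`), by the
1-dimensional universal properties. Injectivity supplies the values on new spans at even steps. At
odd steps, existence and uniqueness of 2-cells out of Kan extensions provide the inserted cells and
the equified equations. At limits, they make the earlier extensions a pseudococone. Finally, a
1-cell of LInj(H) preserves the invariant (`IsSpanKan.comp`), hence the Kan extensions along
`x_{0i}`. Coherence and uniqueness of the pseudococone hold because 2-cells out of its legs are
determined on `X_0`. -/

namespace KanInjective

/-! ### Kan extensions of restrictions, and their inheritance by bicolimits -/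

section KanAlong

variable {K : Type u} [Bicategory.{w, v} K]

/-- `g` is the left Kan extension of its restriction `h ≫ g` along `h`, with identity unit. -/
def IsKanAlong {A B P : K} (h : A ⟶ B) (g : B ⟶ P) : Prop :=
  ∀ (z : B ⟶ P) (θ : h ≫ g ⟶ h ≫ z), ∃! ρ : g ⟶ z, h ◁ ρ = θ

namespace IsKanAlong

variable {A B B' P : K}

theorem hom_ext {h : A ⟶ B} {g z : B ⟶ P} (H : IsKanAlong h g) {ρ ρ' : g ⟶ z}
    (e : h ◁ ρ = h ◁ ρ') : ρ = ρ' :=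
  (H z (h ◁ ρ')).unique e rfl

theorem of_iso {h : A ⟶ B} {g g' : B ⟶ P} (H : IsKanAlong h g) (e : g ≅ g') :
    IsKanAlong h g' := by
  intro z θ
  obtain ⟨ρ, hρ, hu⟩ := H z (h ◁ e.hom ≫ θ)
  refine ⟨e.inv ≫ ρ, by simp [hρ], fun ρ' h' ↦ ?_⟩
  rw [← hu (e.hom ≫ ρ') (by simp [h'])]
  simp

theorem of_iso_left {h h' : A ⟶ B} {g : B ⟶ P} (H : IsKanAlong h g) (e : h ≅ h') :
    IsKanAlong h' g := by
  intro z θ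
  obtain ⟨ρ, hρ, hu⟩ := H z (e.hom ▷ g ≫ θ ≫ e.inv ▷ z)
  refine ⟨ρ, ?_, fun ρ' h'' ↦ hu _ ?_⟩
  · change h' ◁ ρ = θ
    rw [← cancel_epi (e.hom ▷ g), ← whisker_exchange, hρ]
    simp
  · obtain rfl : h' ◁ ρ' = θ := h''
    rw [← whisker_exchange_assoc]
    simp

theorem id (g : A ⟶ P) : IsKanAlong (𝟙 A) g := fun z θ ↦
  ⟨(λ_ g).inv ≫ θ ≫ (λ_ z).hom, by simp, fun ρ h ↦ by simp [← h]⟩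

theorem comp {h : A ⟶ B} {h' : B ⟶ B'} {g : B' ⟶ P} (H : IsKanAlong h (h' ≫ g))
    (H' : IsKanAlong h' g) : IsKanAlong (h ≫ h') g := by
  intro z θ
  obtain ⟨σ, hσ, -⟩ := H (h' ≫ z) ((α_ _ _ _).inv ≫ θ ≫ (α_ _ _ _).hom)
  obtain ⟨ρ, rfl, -⟩ := H' z σ
  refine ⟨ρ, by simp [hσ], fun ρ' h ↦ H'.hom_ext (H.hom_ext ?_)⟩
  rw [hσ, ← h]
  simp

/-- A left extension with invertible unit is a Kan extension iff its 1-cell is the Kan extension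
of its own restriction. -/
theorem isKan_iff {h : A ⟶ B} {f : A ⟶ P} (e : LeftExtension h f) [IsIso e.unit] :
    Nonempty e.IsKan ↔ IsKanAlong h e.extension := by
  constructor
  · rintro ⟨k⟩ z θ
    refine ⟨k.desc (.mk z (e.unit ≫ θ)), ?_, fun ρ hρ ↦ k.hom_ext ?_⟩
    · change h ◁ _ = θ
      rw [← cancel_epi e.unit]
      exact k.fac _
    · rw [k.fac, show h ◁ ρ = θ from hρ]
      rfl
  · intro k
    choose d hd using fun s : LeftExtension h f ↦ (k s.extension (inv e.unit ≫ s.unit)).exists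
    refine ⟨.mk (fun s ↦ LeftExtension.homMk (d s) (by simp [hd])) fun s τ ↦ ?_⟩
    apply StructuredArrow.hom_ext
    apply k.hom_ext
    refine Eq.trans ?_ (hd s).symm
    rw [← LeftExtension.w τ]
    simp

end IsKanAlong

theorem isKanAlong_of_isKan {A B P : K} {h : A ⟶ B} {f : A ⟶ P} {g : B ⟶ P} (u : f ≅ h ≫ g)
    (k : IsKanAlong h g) : Nonempty (LeftExtension.mk g u.hom).IsKan := by
  have i : IsIso (LeftExtension.mk g u.hom).unit := inferInstanceAs (IsIso u.hom)
  exact (IsKanAlong.isKan_iff _).2 k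

theorem IsLeftKanInjective.exists_isKanAlong {H : MorphismProperty K} {P : K}
    (hP : IsLeftKanInjective H P) {A A' : K} (h : A ⟶ A') (hh : H h) (f : A ⟶ P) :
    ∃ g : A' ⟶ P, Nonempty (f ≅ h ≫ g) ∧ IsKanAlong h g := by
  obtain ⟨e, he, hi⟩ := hP h hh f
  exact ⟨e.extension, ⟨@asIso _ _ _ _ e.unit hi⟩, (IsKanAlong.isKan_iff e).1 he⟩

theorem IsLeftKanInjectiveHom.isKanAlong {H : MorphismProperty K} {P Q : K} {u : P ⟶ Q}
    (hu : IsLeftKanInjectiveHom H u) {A A' : K} {h : A ⟶ A'} (hh : H h) {g : A' ⟶ P}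
    (k : IsKanAlong h g) : IsKanAlong h (g ≫ u) := by
  have k' := hu.2.2 h hh _ _ (isKanAlong_of_isKan (Iso.refl _) k)
  have i : IsIso ((LeftExtension.mk g (Iso.refl (h ≫ g)).hom).whisker u).unit := by
    rw [LeftExtension.whisker_unit]
    exact inferInstanceAs (IsIso ((Iso.refl (h ≫ g)).hom ▷ u ≫ (α_ h g u).hom))
  exact (IsKanAlong.isKan_iff _).1 k'

/-- Compatibility with the squares prescribes the component at `f//h` after restriction along `h`.
The Kan property then gives exactly one such component. -/
theorem SpanCocone.IsBicolimit.isKanAlong {H : MorphismProperty K} {X Y P : K} {x : X ⟶ Y}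
    {c : SpanCocone H x} (hc : c.IsBicolimit) (y : Y ⟶ P)
    (k : ∀ ⦃A A' : K⦄ (h : A ⟶ A') (hh : H h) (f : A ⟶ X), IsKanAlong h (c.leg h hh f ≫ y)) :
    IsKanAlong x y := by
  intro z θ
  choose θ' hθ' using fun (A A' : K) (h : A ⟶ A') (hh : H h) (f : A ⟶ X) ↦
    (k h hh f (c.leg h hh f ≫ z) ((α_ _ _ _).inv ≫ (c.sq h hh f).inv ▷ y ≫ (α_ _ _ _).hom ≫
      f ◁ θ ≫ (α_ _ _ _).inv ≫ (c.sq h hh f).hom ▷ z ≫ (α_ _ _ _).hom)).exists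
  obtain ⟨ρ, hρ, hu⟩ := hc.existsUnique_hom y z θ (θ' · · · · ·) (fun A A' h hh f ↦ by simp [hθ'])
  refine ⟨ρ, hρ.1, fun ρ' h' ↦ hu _ ⟨h', fun A A' h hh f ↦ (k h hh f).hom_ext ?_⟩⟩
  obtain rfl : x ◁ ρ' = θ := h'
  have e := whisker_exchange (c.sq h hh f).hom ρ'
  simp only [comp_whiskerLeft, Category.assoc] at e
  simp [hθ', reassoc_of% e]

/-- A 1-cell out of a bicoequinserter is the Kan extension of its restriction as soon as the
restriction of the source of the inserted 2-cell is. -/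
theorem IsBicoequinserter.isKanAlong {A B C Q P : K} {h : A ⟶ B} {f g : B ⟶ C}
    {γ : h ≫ f ⟶ h ≫ g} {q : C ⟶ Q} {φ : f ≫ q ⟶ g ≫ q} (hq : IsBicoequinserter h γ q φ)
    (y : Q ⟶ P) (k : IsKanAlong h (f ≫ q ≫ y)) : IsKanAlong q y := by
  intro z θ
  refine hq.existsUnique_hom y z θ ?_
  have hφ (w : Q ⟶ P) : h ◁ φ ▷ w = (α_ h (f ≫ q) w).inv ≫
      ((α_ h f q).inv ≫ γ ▷ q ≫ (α_ h g q).hom) ▷ w ≫ (α_ h (g ≫ q) w).hom := by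
    rw [hq.condition, whisker_assoc]
    simp
  have e := whisker_exchange γ θ
  simp only [comp_whiskerLeft, whiskerRight_comp, Category.assoc] at e
  have e' := (α_ h f (q ≫ y)).inv ≫= e =≫ ((α_ h g (q ≫ z)).hom)
  -- The required equation is between 2-cells out of a Kan extension along `h`, so it may be tested
  -- there. After restriction `φ` becomes `γ`, and the equation is interchange.
  apply k.hom_ext
  simpa [hφ] using e'

/-- Precomposition with a bicoequifier is already fully faithful. -/
theorem IsBicoequifier.isKanAlong {B C Q P : K} {f g : B ⟶ C} {σ τ : f ⟶ g} {q : C ⟶ Q}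
    (hq : IsBicoequifier σ τ q) (y : Q ⟶ P) : IsKanAlong q y :=
  fun z θ ↦ hq.existsUnique_hom y z θ

theorem IsWideBipushout.isKanAlong {ι : Type s} {X Y P : K} {C : ι → K} {c : ∀ γ, X ⟶ C γ}
    {x : X ⟶ Y} {d : ∀ γ, C γ ⟶ Y} {δ : ∀ γ, x ≅ c γ ≫ d γ} (hx : IsWideBipushout c x d δ)
    (y : Y ⟶ P) (k : ∀ γ, IsKanAlong (c γ) (d γ ≫ y)) : IsKanAlong x y := by
  intro z θ
  choose θ' hθ' using fun γ ↦ (k γ (d γ ≫ z) ((α_ _ _ _).inv ≫ (δ γ).inv ▷ y ≫ θ ≫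
    (δ γ).hom ▷ z ≫ (α_ _ _ _).hom)).exists
  obtain ⟨ρ, hρ, hu⟩ := hx.existsUnique_hom y z θ θ' (fun γ ↦ by simp [hθ'])
  refine ⟨ρ, hρ.1, fun ρ' h' ↦ hu _ ⟨h', fun γ ↦ (k γ).hom_ext ?_⟩⟩
  obtain rfl : x ◁ ρ' = θ := h'
  have e := whisker_exchange (δ γ).hom ρ'
  simp only [comp_whiskerLeft] at e
  simp [hθ', reassoc_of% e]

end KanAlong
-- Even and odd ordinals
section Parity

theorem isEven_zero : IsEven (0 : Ordinal.{t}) :=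
  ⟨0, 0, by simp, by simp⟩

theorem isEven_of_isSuccLimit {k : Ordinal.{t}} (hk : Order.IsSuccLimit k) : IsEven k :=
  ⟨k, 0, hk.isSuccPrelimit, by simp⟩

theorem IsEven.add_one_add_one {i : Ordinal.{t}} (hi : IsEven i) : IsEven (i + 1 + 1) := by
  obtain ⟨l, n, hl, rfl⟩ := hi
  refine ⟨l, n + 1, hl, ?_⟩
  rw [add_assoc, add_assoc, mul_add]
  push_cast
  congr 2
  exact one_add_one_eq_two

theorem isEven_or_exists_eq_add_one (i : Ordinal.{t}) :
    IsEven i ∨ ∃ j : Ordinal.{t}, IsEven j ∧ i = j + 1 := by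
  induction i using Ordinal.limitRecOn with
  | zero => exact .inl isEven_zero
  | add_one i ih =>
    obtain hi | ⟨j, hj, rfl⟩ := ih
    · exact .inr ⟨i, hi, rfl⟩
    · exact .inl hj.add_one_add_one
  | limit i hi _ => exact .inl (isEven_of_isSuccLimit hi)

/-- The finite part of an ordinal is unique because zero and limits cover nothing. This makes
successors of even ordinals odd. -/
theorem eq_of_add_nat_eq {l l' : Ordinal.{t}} (hl : Order.IsSuccPrelimit l)
    (hl' : Order.IsSuccPrelimit l') : ∀ m n : ℕ, l + m = l' + n → m = n
  | 0, 0, _ => rfl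
  | 0, n + 1, h => by
    refine absurd (Order.covBy_add_one (l' + (n : Ordinal.{t}))) ?_
    rw [add_assoc, ← Nat.cast_succ, ← h]
    simpa using hl _
  | m + 1, 0, h => by
    refine absurd (Order.covBy_add_one (l + (m : Ordinal.{t}))) ?_
    rw [add_assoc, ← Nat.cast_succ, h]
    simpa using hl' _
  | m + 1, n + 1, h => by
    rw [eq_of_add_nat_eq hl hl' m n]
    rw [Nat.cast_succ, Nat.cast_succ, ← add_assoc, ← add_assoc] at h
    exact Order.succ_injective h

theorem IsEven.not_isEven_add_one {i : Ordinal.{t}} (hi : IsEven i) : ¬ IsEven (i + 1) := by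
  obtain ⟨l, n, hl, rfl⟩ := hi
  rintro ⟨l', m, hl', e⟩
  rw [add_assoc, ← Nat.cast_succ] at e
  have := eq_of_add_nat_eq hl hl' _ _ e
  omega

theorem parity_induction {motive : Ordinal.{t} → Prop} (zero : motive 0)
    (even_succ : ∀ i, IsEven i → motive i → motive (i + 1))
    (odd_succ : ∀ i, IsEven i → motive (i + 1) → motive (i + 1 + 1))
    (limit : ∀ i, Order.IsSuccLimit i → (∀ j < i, motive j) → motive i) (i : Ordinal.{t}) :
    motive i := by
  induction i using Ordinal.limitRecOn with
  | zero => exact zero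
  | add_one i ih =>
    obtain hi | ⟨j, hj, rfl⟩ := isEven_or_exists_eq_add_one i
    · exact even_succ i hi ih
    · exact odd_succ j hj ih
  | limit i hi ih => exact limit i hi ih

end Parity

/-! ### Coherence of compositors, and pseudococones from Kan extensions -/

namespace Pseudochain

variable {I : Type t} [Preorder I] {K : Type u} [Bicategory.{w, v} K] (F : Pseudochain I K)
  {i j k l : I} {P : K}

/-- The compositor `x_{i,k} ≅ x_{j,k} x_{i,j}` followed by a 1-cell out of `X_k`. -/
def xCompIso (hij : i ≤ j) (hjk : j ≤ k) (p : F.X k ⟶ P) :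
    F.x (hij.trans hjk) ≫ p ≅ F.x hij ≫ F.x hjk ≫ p :=
  whiskerRightIso (F.xComp hij hjk) p ≪≫ α_ _ _ _

theorem xCompIso_hom_naturality (hij : i ≤ j) (hjk : j ≤ k) {p q : F.X k ⟶ P} (ρ : p ⟶ q) :
    (F.xCompIso hij hjk p).hom ≫ F.x hij ◁ F.x hjk ◁ ρ =
      F.x (hij.trans hjk) ◁ ρ ≫ (F.xCompIso hij hjk q).hom := by
  have e := whisker_exchange (F.xComp hij hjk).hom ρ
  simp only [comp_whiskerLeft] at e
  simp [xCompIso, reassoc_of% e]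

theorem xCompIso_assoc (hij : i ≤ j) (hjk : j ≤ k) (hkl : k ≤ l) (p : F.X l ⟶ P) :
    (F.xCompIso hij (hjk.trans hkl) p).hom ≫ F.x hij ◁ (F.xCompIso hjk hkl p).hom =
      (F.xCompIso (hij.trans hjk) hkl p).hom ≫ (F.xCompIso hij hjk (F.x hkl ≫ p)).hom := by
  have e := congrArg (fun η ↦ η ▷ p ≫ (α_ _ _ _).hom ≫ F.x hij ◁ (α_ _ _ _).hom)
    (F.xComp_assoc hij hjk hkl)
  simp [xCompIso] at e ⊢
  simp [← e]

theorem xCompIso_refl (hij : i ≤ j) (p : F.X j ⟶ P) :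
    (F.xCompIso hij le_rfl p).hom ≫ F.x hij ◁ (F.xId j).hom ▷ p ≫ F.x hij ◁ (λ_ p).hom =
      𝟙 _ := by
  have e : (F.xComp hij le_rfl).hom ≫ F.x hij ◁ (F.xId j).hom ≫ (ρ_ _).hom = 𝟙 _ :=
    (F.map₂_right_unitor (homOfLE hij).toLoc).symm.trans (F.map₂_id _)
  have e' := congrArg (· ▷ p) e
  simpa [xCompIso] using e'

/-- A family of 1-cells that are left Kan extensions of one 1-cell out of a least stage underlies
a pseudococone, provided their restrictions are again left Kan extensions. -/
theorem exists_pseudococone {o : I} (ho : ∀ i, o ≤ i) (L : ∀ i, F.X i ⟶ P) {p : F.X o ⟶ P}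
    (u : ∀ i, F.x (ho i) ≫ L i ≅ p)
    (hL : ∀ ⦃i j : I⦄ (h : i ≤ j), IsKanAlong (F.x (ho i)) (F.x h ≫ L j)) :
    ∃ c : Pseudococone F P, c.leg = L := by
  have hL' (i : I) : IsKanAlong (F.x (ho i)) (L i) :=
    (hL le_rfl).of_iso (whiskerRightIso (F.xId i) (L i) ≪≫ λ_ _)
  -- Both `L i` and the restriction of `L j` to stage `i` are Kan extensions of `p` up to
  -- isomorphism. The comparisons `a`, `b` and all their laws are therefore fixed by restriction to
  -- the least stage.
  choose a ha using fun (i j : I) (h : i ≤ j) ↦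
    (hL' i (F.x h ≫ L j) ((u i).hom ≫ (u j).inv ≫ (F.xCompIso (ho i) h (L j)).hom)).exists
  choose b hb using fun (i j : I) (h : i ≤ j) ↦
    (hL h (L i) ((F.xCompIso (ho i) h (L j)).inv ≫ (u j).hom ≫ (u i).inv)).exists
  refine ⟨{
    leg := L
    iso {i j} h := ⟨a i j h, b i j h, (hL' i).hom_ext (by simp [ha, hb]),
      (hL h).hom_ext (by simp [ha, hb])⟩
    iso_refl i := (hL' i).hom_ext (by simp [ha, xCompIso_refl])
    iso_trans {i j k} hij hjk := (hL' i).hom_ext ?_ }, rfl⟩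
  change F.x (ho i) ◁ (a i k _ ≫ (F.xCompIso hij hjk (L k)).hom) = _
  simp [ha, xCompIso_assoc, xCompIso_hom_naturality]

end Pseudochain

/-! ### The invariant, and why it gives Kan extensions along `x_{0k}` -/

section Chain

variable {K : Type u} [Bicategory.{w, v} K] {H : MorphismProperty K}
  (C : KanInjectivePseudochain.{t} H)

/-- The 1-cell `p : X_k ⟶ P` preserves the formal extensions `f//h` as left Kan extensions. -/
def IsSpanKan {k : Ordinal.{t}} {P : K} (p : C.chain.X k ⟶ P) : Prop :=
  ∀ ⦃j : Ordinal.{t}⦄ (hj : IsEven j) (hjk : j + 1 ≤ k) ⦃A A' : K⦄ (h : A ⟶ A') (hh : H h)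
    (f : A ⟶ C.chain.X j), IsKanAlong h ((C.span j hj).leg h hh f ≫ C.chain.x hjk ≫ p)

namespace IsSpanKan

variable {C} {i k : Ordinal.{t}} {P : K} {p : C.chain.X k ⟶ P}

theorem of_iso (hp : IsSpanKan C p) {q : C.chain.X k ⟶ P} (e : p ≅ q) : IsSpanKan C q :=
  fun _ hj hjk _ _ h hh f ↦
    (hp hj hjk h hh f).of_iso (whiskerLeftIso _ (whiskerLeftIso _ e))

theorem precomp (hp : IsSpanKan C p) (hik : i ≤ k) : IsSpanKan C (C.chain.x hik ≫ p) :=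
  fun _ hj hji _ _ h hh f ↦ (hp hj (hji.trans hik) h hh f).of_iso (whiskerLeftIso _
    (C.chain.xCompIso hji hik p))

/-- It suffices to check the property after restriction to enough earlier stages. -/
theorem of_precomp
    (hp : ∀ ⦃j : Ordinal.{t}⦄, IsEven j → j + 1 ≤ k → ∃ (i : Ordinal.{t}) (_ : j + 1 ≤ i)
      (hik : i ≤ k), IsSpanKan C (C.chain.x hik ≫ p)) : IsSpanKan C p := by
  intro j hj hjk A A' h hh f
  obtain ⟨i, hji, hik, hi⟩ := hp hj hjk
  exact (hi hj hji h hh f).of_iso (whiskerLeftIso _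
    (C.chain.xCompIso hji hik p).symm)

theorem comp (hp : IsSpanKan C p) {Q : K} {r : P ⟶ Q} (hr : IsLeftKanInjectiveHom H r) :
    IsSpanKan C (p ≫ r) :=
  fun _ hj hjk _ _ h hh f ↦ (hr.isKanAlong hh (hp hj hjk h hh f)).of_iso
    (α_ _ _ _ ≪≫ whiskerLeftIso _ (α_ _ _ _))

theorem isKanAlong_even {p : C.chain.X (i + 1) ⟶ P} (hp : IsSpanKan C p) (hi : IsEven i) :
    IsKanAlong (C.chain.x (le_self_add : i ≤ i + 1)) p :=
  (C.span_isBicolimit i hi).isKanAlong p fun _ _ h hh f ↦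
    (hp hi le_rfl h hh f).of_iso
      (whiskerLeftIso _ (whiskerRightIso (C.chain.xId _) p ≪≫ λ_ p))

/-- Each inserted 2-cell has source `x_{j+1,i+1}(f//h)`, which the invariant makes Kan along `h`, so
its naturality is automatic; equifiers impose nothing. -/
theorem isKanAlong_odd {p : C.chain.X (i + 1 + 1) ⟶ P} (hp : IsSpanKan C p) (hi : IsEven i) :
    IsKanAlong (C.chain.x (le_self_add : i + 1 ≤ i + 1 + 1)) p := by
  refine (C.step i hi).wideBipushout.isKanAlong p ?_
  rintro (a | b)
  · refine ((C.step i hi).bicoequinserter a).isKanAlong _ ?_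
    have hai : a.j + 1 ≤ i + 1 := by gcongr; exact a.le
    refine (hp.precomp le_self_add a.even hai a.h a.mem a.f).of_iso ?_
    exact (α_ _ _ _).symm ≪≫ whiskerLeftIso _
      (whiskerRightIso ((C.step i hi).δ (.inl a)) p ≪≫ α_ _ _ _)
  · exact ((C.step i hi).bicoequifier b).isKanAlong _

theorem isKanAlong_of_isSuccLimit (hk : Order.IsSuccLimit k)
    (hp : ∀ i (hi : i < k), IsKanAlong (C.chain.x (zero_le : 0 ≤ i)) (C.chain.x hi.le ≫ p)) :
    IsKanAlong (C.chain.x (zero_le : 0 ≤ k)) p := by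
  intro z θ
  choose θ' hθ' using fun i : Set.Iio k ↦ (hp i i.2 (C.chain.x (le_of_lt i.2) ≫ z)
    ((C.chain.xCompIso zero_le (le_of_lt i.2) p).inv ≫ θ ≫
      (C.chain.xCompIso zero_le (le_of_lt i.2) z).hom)).exists
  -- Restriction to any one stage below `k` carries the same information as restriction to `X_0`;
  -- the end of the proof uses stage 0.
  have hθ (ρ : p ⟶ z) (i : Set.Iio k) :
      C.chain.x (le_of_lt i.2) ◁ ρ = θ' i ↔ C.chain.x (zero_le : 0 ≤ k) ◁ ρ = θ := by
    have e := C.chain.xCompIso_hom_naturality zero_le (le_of_lt i.2) ρ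
    constructor
    · rintro h
      simpa [h, hθ'] using e.symm
    · rintro rfl
      refine (hp i i.2).hom_ext ?_
      simp [hθ', ← e]
  have hmod : Pseudococone.IsModification ((C.chain.belowCocone k).whisker p)
      ((C.chain.belowCocone k).whisker z) θ' := by
    intro i j h
    -- The modification law is also tested on `X_0`, where every `θ' i` is `θ` up to compositors.
    refine (hp i i.2).hom_ext ?_
    change C.chain.x zero_le ◁ (θ' i ≫ (C.chain.xCompIso h (le_of_lt j.2) z).hom) =
      C.chain.x zero_le ◁ ((C.chain.xCompIso h (le_of_lt j.2) p).hom ≫ C.chain.x h ◁ θ' j)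
    rw [← cancel_epi (C.chain.xCompIso zero_le (le_of_lt i.2) p).hom]
    simp [hθ', C.chain.xCompIso_assoc, reassoc_of% C.chain.xCompIso_assoc,
      C.chain.xCompIso_hom_naturality]
  obtain ⟨ρ, hρ, hu⟩ := (C.limit_isBicolimit k hk).existsUnique_hom p z θ' hmod
  exact ⟨ρ, (hθ ρ ⟨0, hk.bot_lt⟩).1 (hρ ⟨0, hk.bot_lt⟩), fun ρ' h' ↦ hu _ fun i ↦ (hθ ρ' i).2 h'⟩

/-- A 1-cell preserving the formal extensions is the Kan extension of its restriction to `X_0`. -/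
theorem isKanAlong (hp : IsSpanKan C p) : IsKanAlong (C.chain.x (zero_le : 0 ≤ k)) p := by
  induction k using parity_induction with
  | zero => exact (IsKanAlong.id p).of_iso_left (C.chain.xId 0).symm
  | even_succ i hi ih =>
    exact ((ih (hp.precomp le_self_add)).comp (hp.isKanAlong_even hi)).of_iso_left
      (C.chain.xComp _ _).symm
  | odd_succ i hi ih =>
    exact ((ih (hp.precomp le_self_add)).comp (hp.isKanAlong_odd hi)).of_iso_left
      (C.chain.xComp _ _).symm
  | limit k hk ih =>
    exact isKanAlong_of_isSuccLimit hk fun i hi ↦ ih i hi (hp.precomp hi.le)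

end IsSpanKan

end Chain
-- Extending 1-cells along the chain
section Existence

variable {K : Type u} [Bicategory.{w, v} K] {H : MorphismProperty K}
  (C : KanInjectivePseudochain.{t} H) {P : K}

theorem IsLeftKanInjective.exists_even (hP : IsLeftKanInjective H P) {i : Ordinal.{t}}
    (hi : IsEven i) {p : C.chain.X i ⟶ P} (hp : IsSpanKan C p) :
    ∃ r : C.chain.X (i + 1) ⟶ P, IsSpanKan C r ∧
      Nonempty (C.chain.x (le_self_add : i ≤ i + 1) ≫ r ≅ p) := by
  choose g u hg using fun (A A' : K) (h : A ⟶ A') (hh : H h) (f : A ⟶ C.chain.X i) ↦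
    hP.exists_isKanAlong h hh (f ≫ p)
  obtain ⟨r, τ, τ', -⟩ := (C.span_isBicolimit i hi).exists_desc p
    ⟨fun h hh f ↦ g _ _ h hh f, fun h hh f ↦ (u _ _ h hh f).some⟩
  refine ⟨r, fun j hj hji A A' h hh f ↦ ?_, ⟨τ⟩⟩
  -- For `j = i` the formal extension is new and goes to the chosen Kan extension `g`; for `j < i`
  -- it already lives in `X_i`, where `hp` applies.
  obtain rfl | hji' := (Order.lt_add_one_iff.1 (Order.add_one_le_iff.1 hji)).eq_or_lt
  · exact (hg _ _ h hh f).of_iso ((τ' h hh f).symm ≪≫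
      whiskerLeftIso _ ((λ_ r).symm ≪≫ whiskerRightIso (C.chain.xId _).symm r))
  · have hji' := Order.add_one_le_of_lt hji'
    exact (hp hj hji' h hh f).of_iso (whiskerLeftIso _ (whiskerLeftIso _ τ.symm ≪≫
      (C.chain.xCompIso hji' le_self_add r).symm))

theorem IsSpanKan.exists_odd {i : Ordinal.{t}} (hi : IsEven i) {p : C.chain.X (i + 1) ⟶ P}
    (hp : IsSpanKan C p) :
    ∃ r : C.chain.X (i + 1 + 1) ⟶ P, IsSpanKan C r ∧
      Nonempty (C.chain.x (le_self_add : i + 1 ≤ i + 1 + 1) ≫ r ≅ p) := by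
  have hspan {j : Ordinal.{t}} (hj : IsEven j) (hji : j ≤ i) {A A' : K} (h : A ⟶ A') (hh : H h)
      (f : A ⟶ C.chain.X j) : IsKanAlong h (spanLeg C.span hj hji h hh f ≫ p) :=
    (hp hj (by gcongr) h hh f).of_iso (α_ _ _ _).symm
  have hfac (γ : StepIndex C.span i) :
      -- Existence in the Kan property gives the 2-cell to be inserted; uniqueness identifies `σ`
      -- and `τ` after composing with `p`.
      ∃ e : (C.step i hi).C γ ⟶ P, Nonempty ((C.step i hi).c γ ≫ e ≅ p) := by
    obtain a | b := γ
    · obtain ⟨ψ, hψ, -⟩ := hspan a.even a.le a.h a.mem a.f (a.g ≫ p)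
        ((α_ _ _ _).inv ≫ a.cell C.span ▷ p ≫ (α_ _ _ _).hom)
      obtain ⟨r, τ, -⟩ := ((C.step i hi).bicoequinserter a).exists_desc p ψ hψ.symm
      exact ⟨r, ⟨τ⟩⟩
    · refine ((C.step i hi).bicoequifier b).exists_desc p ?_
      refine (hspan b.even b.le b.h b.mem b.f).hom_ext ?_
      have e := congrArg (fun η ↦ (α_ _ _ _).inv ≫ η ▷ p ≫ (α_ _ _ _).hom) b.eq
      simpa using e
  choose e η using hfac
  obtain ⟨r, τ, -⟩ := (C.step i hi).wideBipushout.exists_desc p e fun γ ↦ (η γ).some.symm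
  -- An odd step adds no formal extensions: `j = i + 1` is excluded by parity, so all of them factor
  -- through `X_{i+1}`.
  refine ⟨r, of_precomp fun j hj hji ↦ ⟨i + 1, ?_, le_self_add, hp.of_iso τ.symm⟩, ⟨τ⟩⟩
  refine Order.add_one_le_of_lt ((Order.lt_add_one_iff.1 (Order.add_one_le_iff.1 hji)).lt_of_ne ?_)
  rintro rfl
  exact hi.not_isEven_add_one hj

/-- The earlier extensions may be chosen independently: being Kan extensions of the same `p₀`, they
are linked by unique coherent isomorphisms. -/
theorem IsSpanKan.exists_of_isSuccLimit {k : Ordinal.{t}} (hk : Order.IsSuccLimit k)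
    {p₀ : C.chain.X 0 ⟶ P}
    (hp : ∀ i < k, ∃ p : C.chain.X i ⟶ P, IsSpanKan C p ∧
      Nonempty (C.chain.x (zero_le : 0 ≤ i) ≫ p ≅ p₀)) :
    ∃ p : C.chain.X k ⟶ P, IsSpanKan C p ∧
      Nonempty (C.chain.x (zero_le : 0 ≤ k) ≫ p ≅ p₀) := by
  choose L hL u using hp
  let o : Set.Iio k := ⟨0, hk.bot_lt⟩
  have u' (i : Set.Iio k) :
      C.chain.x (zero_le : 0 ≤ i.1) ≫ L i i.2 ≅ C.chain.x le_rfl ≫ L 0 hk.bot_lt :=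
    (u i i.2).some ≪≫ (u 0 hk.bot_lt).some.symm
  obtain ⟨d, hd⟩ := (C.chain.below k).exists_pseudococone (o := o)
    (fun i ↦ (zero_le : 0 ≤ i.1))
    (fun i ↦ L i.1 i.2) u' fun i j h ↦ ((hL j.1 j.2).precomp h).isKanAlong
  obtain ⟨r, θ, -⟩ := (C.limit_isBicolimit k hk).exists_desc d
  have θ' (i : Ordinal.{t}) (hi : i < k) : C.chain.x hi.le ≫ r ≅ L i hi :=
    θ ⟨i, hi⟩ ≪≫ eqToIso (congrFun hd ⟨i, hi⟩)
  refine ⟨r, of_precomp fun j hj hjk ↦ ?_,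
    ⟨C.chain.xCompIso le_rfl _ r ≪≫ whiskerLeftIso _ (θ' 0 hk.bot_lt) ≪≫ (u 0 hk.bot_lt).some⟩⟩
  -- Since `k` is a limit, each formal extension already appears at a stage `j + 1 < k`.
  have hjk' := hk.add_one_lt (Order.add_one_le_iff.1 hjk)
  exact ⟨j + 1, le_rfl, hjk, (hL _ hjk').of_iso (θ' _ hjk').symm⟩

theorem IsLeftKanInjective.exists_isSpanKan (hP : IsLeftKanInjective H P)
    (p₀ : C.chain.X 0 ⟶ P) (k : Ordinal.{t}) :
    ∃ p : C.chain.X k ⟶ P, IsSpanKan C p ∧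
      Nonempty (C.chain.x (zero_le : 0 ≤ k) ≫ p ≅ p₀) := by
  induction k using parity_induction with
  | zero =>
    exact ⟨p₀, fun j _ hj ↦ absurd (Order.add_one_le_iff.1 hj) not_lt_zero,
      ⟨whiskerRightIso (C.chain.xId 0) p₀ ≪≫ λ_ p₀⟩⟩
  | even_succ i hi ih =>
    obtain ⟨p, hp, ⟨e⟩⟩ := ih
    obtain ⟨r, hr, ⟨τ⟩⟩ := hP.exists_even C hi hp
    exact ⟨r, hr, ⟨C.chain.xCompIso zero_le _ r ≪≫ whiskerLeftIso _ τ ≪≫ e⟩⟩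
  | odd_succ i hi ih =>
    obtain ⟨p, hp, ⟨e⟩⟩ := ih
    obtain ⟨r, hr, ⟨τ⟩⟩ := hp.exists_odd C hi
    exact ⟨r, hr, ⟨C.chain.xCompIso zero_le _ r ≪≫ whiskerLeftIso _ τ ≪≫ e⟩⟩
  | limit k hk ih => exact IsSpanKan.exists_of_isSuccLimit C hk ih

theorem IsLeftKanInjective.fromZero (hP : IsLeftKanInjective H P) :
    IsLeftKanInjective C.fromZero P := by
  rintro _ _ _ ⟨i⟩ f
  obtain ⟨p, hp, ⟨e⟩⟩ := hP.exists_isSpanKan C f i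
  exact ⟨.mk p e.inv, isKanAlong_of_isKan e.symm hp.isKanAlong, inferInstanceAs (IsIso e.inv)⟩

theorem IsLeftKanInjectiveHom.fromZero {Q : K} {r : P ⟶ Q} (hr : IsLeftKanInjectiveHom H r) :
    IsLeftKanInjectiveHom C.fromZero r := by
  refine ⟨hr.1.fromZero C, hr.2.1.fromZero C, ?_⟩
  rintro _ _ _ ⟨i⟩ f e ⟨he⟩
  obtain ⟨p, hp, ⟨u⟩⟩ := hr.1.exists_isSpanKan C f i
  obtain ⟨hk⟩ := isKanAlong_of_isKan u.symm hp.isKanAlong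
  -- Any Kan extension of `f` is isomorphic to the constructed one, so preservation need only be
  -- known for the latter.
  exact ⟨.whiskerOfCommute _ _ (hk.uniqueUpToIso he) r (isKanAlong_of_isKan
    (whiskerRightIso u.symm r ≪≫ α_ _ _ _) (hp.comp hr).isKanAlong).some⟩

theorem IsLeftKanInjective.exists_isKanExtensionOf (hP : IsLeftKanInjective H P)
    (p₀ : C.chain.X 0 ⟶ P) : ∃ p : Pseudococone C.chain P, p.IsKanExtensionOf p₀ := by
  -- The last clause makes the leg at 0 equal to `p₀`, not merely isomorphic to it.
  have hex (i : Ordinal.{t}) : ∃ p : C.chain.X i ⟶ P, (IsSpanKan C p ∧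
      Nonempty (C.chain.x (zero_le : 0 ≤ i) ≫ p ≅ p₀)) ∧ ∀ h : i = 0, p = h ▸ p₀ := by
    obtain rfl | hi := eq_or_ne i 0
    · exact ⟨p₀, ⟨fun j _ hj ↦ absurd (Order.add_one_le_iff.1 hj) not_lt_zero,
        ⟨whiskerRightIso (C.chain.xId 0) p₀ ≪≫ λ_ p₀⟩⟩, fun _ ↦ rfl⟩
    · obtain ⟨p, hp⟩ := hP.exists_isSpanKan C p₀ i
      exact ⟨p, hp, fun h ↦ absurd h hi⟩
  choose L hL hL₀ using hex
  obtain ⟨c, rfl⟩ := C.chain.exists_pseudococone (fun i ↦ (zero_le : 0 ≤ i)) L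
    (fun i ↦ (hL i).2.some) fun i j h ↦ ((hL j).1.precomp h).isKanAlong
  exact ⟨c, hL₀ 0 rfl, fun i ↦ isKanAlong_of_isKan (c.iso _) (hL i).1.isKanAlong⟩

end Existence

/-! ### Uniqueness of the extended pseudococone -/

section Uniqueness

variable {K : Type u} [Bicategory.{w, v} K] {F : Pseudochain Ordinal.{t} K} {P : K}
  {p q : Pseudococone F P} {p₀ : F.X 0 ⟶ P}

theorem Pseudococone.iso_refl_hom (c : Pseudococone F P) (i : Ordinal.{t}) :
    (c.iso (le_refl i)).hom = (λ_ _).inv ≫ (F.xId i).inv ▷ c.leg i := by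
  have e := c.iso_refl i =≫ ((λ_ _).inv ≫ (F.xId i).inv ▷ c.leg i)
  simpa using e

theorem Pseudococone.IsKanExtensionOf.isKanAlong (hp : p.IsKanExtensionOf p₀) (i : Ordinal.{t}) :
    IsKanAlong (F.x (zero_le : 0 ≤ i)) (p.leg i) := by
  have : IsIso (LeftExtension.mk (p.leg i) (p.iso (zero_le : 0 ≤ i)).hom).unit :=
    inferInstanceAs (IsIso (p.iso _).hom)
  exact (IsKanAlong.isKan_iff _).1 (hp.2 i)

theorem Pseudococone.IsKanExtensionOf.existsUnique_iso (hp : p.IsKanExtensionOf p₀)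
    (hq : q.IsKanExtensionOf p₀) :
    ∃! θ : ∀ i : Ordinal.{t}, p.leg i ≅ q.leg i, p.IsModification q (fun i ↦ (θ i).hom) ∧
      (θ 0).hom = eqToHom (hp.1.trans hq.1.symm) := by
  have e₀ : p.leg 0 = q.leg 0 := hp.1.trans hq.1.symm
  choose a ha using fun i ↦ (hp.isKanAlong i (q.leg i)
    ((p.iso zero_le).inv ≫ eqToHom e₀ ≫ (q.iso zero_le).hom)).exists
  choose b hb using fun i ↦ (hq.isKanAlong i (p.leg i)
    ((q.iso zero_le).inv ≫ eqToHom e₀.symm ≫ (p.iso zero_le).hom)).exists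
  let θ (i : Ordinal.{t}) : p.leg i ≅ q.leg i :=
    ⟨a i, b i, (hp.isKanAlong i).hom_ext (by simp [ha, hb]),
      (hq.isKanAlong i).hom_ext (by simp [ha, hb])⟩
  have trans (c : Pseudococone F P) {i j : Ordinal.{t}} (h : i ≤ j) :
      F.x (zero_le : 0 ≤ i) ◁ (c.iso h).hom = (c.iso zero_le).inv ≫ (c.iso zero_le).hom ≫
        (F.xCompIso zero_le h (c.leg j)).hom := by
    rw [Iso.eq_inv_comp]
    simpa [Pseudochain.xCompIso] using (c.iso_trans zero_le h).symm
  refine ⟨θ, ⟨fun i j h ↦ (hp.isKanAlong i).hom_ext ?_, ?_⟩, fun θ' ⟨h, h₀⟩ ↦ ?_⟩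
  · have e := F.xCompIso_hom_naturality zero_le h (a j)
    simp [θ, ha, trans, e]
  · change a 0 = _
    -- At stage 0 the units are the unit constraints of `x_{00}`, so conjugating by them is
    -- whiskering with `x_{00}`.
    have e (η : p.leg 0 ⟶ q.leg 0) : (p.iso (le_refl 0)).inv ≫ η ≫ (q.iso (le_refl 0)).hom =
        F.x (le_refl 0) ◁ η := by
      rw [Iso.inv_comp_eq, p.iso_refl_hom, q.iso_refl_hom, Category.assoc, ← whisker_exchange]
      simp
    exact (hp.isKanAlong 0).hom_ext ((ha 0).trans (e _))
  · funext i
    ext1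
    refine (hp.isKanAlong i).hom_ext ?_
    change _ = _ ◁ a i
    -- The modification law for `0 ≤ i` forces the component at `i` from the one at 0.
    rw [ha, ← h₀, Iso.eq_inv_comp]
    exact (h zero_le).symm

end Uniqueness

end KanInjective

theorem lemma3p3 {K : Type u} [Bicategory.{w, v} K] (H : MorphismProperty K)
    (C : KanInjective.KanInjectivePseudochain.{t} H) :
    ((∀ P : K, KanInjective.IsLeftKanInjective H P →
        KanInjective.IsLeftKanInjective C.fromZero P) ∧
      (∀ ⦃P Q : K⦄ (u : P ⟶ Q), KanInjective.IsLeftKanInjectiveHom H u →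
        KanInjective.IsLeftKanInjectiveHom C.fromZero u)) ∧
    (∀ P : K, KanInjective.IsLeftKanInjective H P → ∀ p₀ : C.chain.X 0 ⟶ P,
      (∃ p : KanInjective.Pseudococone C.chain P, p.IsKanExtensionOf p₀) ∧
      (∀ p q : KanInjective.Pseudococone C.chain P,
        ∀ (hp : p.IsKanExtensionOf p₀) (hq : q.IsKanExtensionOf p₀),
          ∃! θ : ∀ i : Ordinal.{t}, p.leg i ≅ q.leg i,
            p.IsModification q (fun i ↦ (θ i).hom) ∧
              (θ 0).hom = eqToHom (hp.1.trans hq.1.symm))) :=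
  ⟨⟨fun _ hP ↦ hP.fromZero C, fun _ _ _ hu ↦ hu.fromZero C⟩, fun _ hP p₀ ↦
    ⟨hP.exists_isKanExtensionOf C p₀, fun _ _ hp hq ↦ hp.existsUnique_iso hq⟩⟩
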